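/- Let $X$ be a (real) Banach space and let $G$ be an additive abelian group with a norm $|\cdot|$ (so $|g|\ge 0$ with equality only for $g=0$, $|-g|=|g|$, $|g+h|\le|g|+|h|$) that is complete in the metric $|g-h|$. A polyhedral $0$-chain is a finite formal sum $P=\sum_i g_i[x_i]$ with $g_i\in G$ and distinct $x_i\in X$; its mass is $M(P)=\sum_i|g_i|$. A polyhedral $1$-chain is a finite formal sum $\sum_i g_i[x_i,y_i]$ of oriented segments with coefficients in $G$, modulo $(g+h)[x,y]=g[x,y]+h[x,y]$, $g[y,x]=(-g)[x,y]$, $g[x,x]=0$ and $g[x,z]=g[x,y]+g[y,z]$ for $y$ in the open segment from $x$ to $z$; its boundary is given by $\partial(g[x,y])=g[y]-g[x]$. For $f\in X^*$ and almost every $r\in\mathbf R$ let $P_r$ be the portion of a polyhedral chain $P$ in $f^{-1}((-\infty,r))$. The mass of a simple $1$-chain $P=g[x,y]$ is $$M(P)=\sup_{f\in X^*,\ \|f\|=1}\int_{-\infty}^{\infty}M\big(\partial(P_r)-(\partial P)_r\big)\,dr ,$$ and the mass of an arbitrary polyhedral $1$-chain is the sum of the masses of the summands in a representation of it by simple chains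 on non-degenerate, pairwise disjoint open segments. The flat norm of a polyhedral $0$-chain $P$ is $$F(P)=\inf_Q\big(M(Q)+M(\partial Q-P)\big),$$ the infimum being over all polyhedral $1$-chains $Q$. Flat $0$-chains are the elements of the completion $\mathcal C_0(X,G)$ of the group of polyhedral $0$-chains in the norm $F$. The mass $M(A)\in[0,\infty]$ of $A\in\mathcal C_0(X,G)$ is the smallest $m$ for which there are polyhedral $0$-chains $P_i\to A$ with $M(P_i)\to m$. For a $0$-chain $P$ let $P\llcorner B(x,r)$ be its portion in the open ball $B(x,r)$. Let $A\in\mathcal C_0(X,G)$ and let $(P_i)$ be polyhedral $0$-chains converging rapidly to $A$, that is, $\sum_iF(P_i-A)<\infty$. A radius $r$ is non-exceptional (for $x$ and $(P_i)$) if $\sum_iF\big((P_{i+1}-P_i)\llcorner B(x,r)\big)<\infty$; then $A\llcorner B(x,r)=\lim_iP_i\llcorner B(x,r)$ exists in $\mathcal C_0(X,G)$. The support $\operatorname{spt}(A)$ is the set of those $x\in X$ for which, whichever rapidly converging sequence $(P_i)$ is used, there are non-exceptional radii $r_j\downarrow0$ with $F(A\llcorner B(x,r_j))>0$ for all $j$.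 Proposition. Let $(A_j)$ be a sequence in $\mathcal C_0(X,G)$ such that 1. the set $G_d=\{g\in G:|g|\le d\}$ is compact for all $d\in\mathbf R$; 2. there is a compact set $K\subset X$ with $\operatorname{spt}(A_j)\subset K$ for all $j$; 3. there is a constant $q$ with $M(A_j)\le q$ for all $j$. Then $(A_j)$ has a subsequence that converges in $\mathcal C_0(X,G)$ with respect to the flat norm. -/

import Mathlib

open Filter Topology MeasureTheory
open scoped ENNReal NNReal

noncomputable section

namespace FlatChain

/-! ### Polyhedral `0`-chains -/

/-- Polyhedral `0`-chains in `X` with coefficients in `G`: finite formal sums `∑ gᵢ [xᵢ]`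
of points. (A type synonym, so that it can carry the flat norm.) -/
def ZeroChain (X G : Type*) [NormedAddCommGroup G] : Type _ := X →₀ G

section Zero

variable {X G : Type*} [NormedAddCommGroup G]

instance : AddCommGroup (ZeroChain X G) := inferInstanceAs (AddCommGroup (X →₀ G))

/-- The `0`-chain `g [x]`. -/
def pt (x : X) : G →+ ZeroChain X G := Finsupp.singleAddHom x

/-- The mass `∑ |gᵢ|` of the `0`-chain `∑ gᵢ [xᵢ]` with distinct `xᵢ`. -/
def mass0 (P : ZeroChain X G) : ℝ≥0∞ := Finsupp.sum P fun _ g => ‖g‖ₑ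

/-- The portion of the `0`-chain `P` in `f⁻¹((-∞, r))`. -/
def restrict0 (f : X → ℝ) (r : ℝ) : ZeroChain X G →+ ZeroChain X G :=
  Finsupp.filterAddHom fun x => f x < r

theorem mass0_zero : mass0 (0 : ZeroChain X G) = 0 := Finsupp.sum_zero_index

theorem mass0_pt (x : X) (g : G) : mass0 (pt x g) = ‖g‖ₑ :=
  Finsupp.sum_single_index (by simp)

theorem mass0_neg (P : ZeroChain X G) : mass0 (-P) = mass0 P := by
  have h := Finsupp.sum_neg_index (g := (P : X →₀ G)) (h := fun _ g => ‖g‖ₑ) (by simp)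
  refine h.trans ?_
  simp [mass0]

theorem mass0_add_le (P Q : ZeroChain X G) : mass0 (P + Q) ≤ mass0 P + mass0 Q := by
  classical
  let p : X →₀ G := P
  let q : X →₀ G := Q
  have e1 : mass0 P = ∑ x ∈ p.support ∪ q.support, ‖p x‖ₑ :=
    Finsupp.sum_of_support_subset p Finset.subset_union_left _ (by simp)
  have e2 : mass0 Q = ∑ x ∈ p.support ∪ q.support, ‖q x‖ₑ :=
    Finsupp.sum_of_support_subset q Finset.subset_union_right _ (by simp)
  have e3 : mass0 (P + Q) = ∑ x ∈ p.support ∪ q.support, ‖(p + q) x‖ₑ :=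
    Finsupp.sum_of_support_subset (p + q) Finsupp.support_add _ (by simp)
  rw [e1, e2, e3, ← Finset.sum_add_distrib]
  exact Finset.sum_le_sum fun x _ => enorm_add_le _ _

theorem mass0_ne_top (P : ZeroChain X G) : mass0 P ≠ ∞ :=
  (ENNReal.sum_lt_top.2 fun _ _ => enorm_lt_top).ne

end Zero

/-! ### Polyhedral `1`-chains -/

section One


variable {X G : Type*} [NormedAddCommGroup X] [NormedSpace ℝ X] [NormedAddCommGroup G]

variable (X G) in
/-- The relations between formal sums of oriented segments; the pair `(x, y)` is the segment
from `x` to `y`. A degenerate segment is zero, reversing the orientation changes the sign, and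
a segment is the sum of the two pieces into which an interior point divides it. -/
def relations : AddSubgroup (X × X →₀ G) :=
  AddSubgroup.closure
    ({c | ∃ x g, c = Finsupp.single (x, x) g} ∪
     {c | ∃ x y g, c = Finsupp.single (x, y) g + Finsupp.single (y, x) g} ∪
     {c | ∃ x y z g, y ∈ openSegment ℝ x z ∧
        c = Finsupp.single (x, z) g - Finsupp.single (x, y) g - Finsupp.single (y, z) g})

variable (X G) in
/-- Polyhedral `1`-chains in `X` with coefficients in `G`. -/
def OneChain : Type _ := (X × X →₀ G) ⧸ relations X G

instance : AddCommGroup (OneChain X G) :=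
  inferInstanceAs (AddCommGroup ((X × X →₀ G) ⧸ relations X G))

/-- The simple `1`-chain `g [x, y]`. -/
def seg (x y : X) : G →+ OneChain X G :=
  (QuotientAddGroup.mk' (relations X G)).comp (Finsupp.singleAddHom (x, y))

/-- The boundary on formal sums of segments. -/
def boundaryFree : (X × X →₀ G) →+ ZeroChain X G :=
  Finsupp.liftAddHom fun p => pt p.2 - pt p.1

theorem boundaryFree_single (x y : X) (g : G) :
    boundaryFree (Finsupp.single (x, y) g) = pt y g - pt x g := by
  simp [boundaryFree]

/-- The boundary operator, `∂ (g [x, y]) = g [y] - g [x]`. -/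
def boundary : OneChain X G →+ ZeroChain X G :=
  QuotientAddGroup.lift (relations X G) boundaryFree (by
    rw [relations, AddSubgroup.closure_le]
    rintro c ((⟨x, g, rfl⟩ | ⟨x, y, g, rfl⟩) | ⟨x, y, z, g, -, rfl⟩) <;>
      simp only [SetLike.mem_coe, AddMonoidHom.mem_ker, map_add, map_sub, boundaryFree_single] <;>
      abel)

/-- The portion of `g [x, y]` in `f⁻¹((-∞, r))`, for a linear functional `f`. -/
def portion (f : X →L[ℝ] ℝ) (r : ℝ) (g : G) (x y : X) : OneChain X G :=
  let p := AffineMap.lineMap x y ((r - f x) / (f y - f x))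
  if f x < r then
    if f y < r then seg x y g else seg x p g
  else
    if f y < r then seg p y g else 0

/-- The slice `∂(P_r) - (∂P)_r` of `P = g [x, y]` by `f` at `r`. -/
def slice (f : X →L[ℝ] ℝ) (r : ℝ) (g : G) (x y : X) : ZeroChain X G :=
  boundary (portion f r g x y) - restrict0 f r (boundary (seg x y g))

/-- The mass of the simple `1`-chain `g [x, y]`. -/
def simpleMass (g : G) (x y : X) : ℝ≥0∞ :=
  ⨆ (f : X →L[ℝ] ℝ) (_ : ‖f‖ = 1), ∫⁻ r : ℝ, mass0 (slice f r g x y)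

/-- The segments from `x i` to `y i` are non-degenerate and pairwise disjoint
(as open segments). -/
def NonOverlapping {ι : Type*} (x y : ι → X) : Prop :=
  (∀ i, x i ≠ y i) ∧
    Pairwise fun i j => Disjoint (openSegment ℝ (x i) (y i)) (openSegment ℝ (x j) (y j))

/-- The mass of a polyhedral `1`-chain: the sum of the masses of the summands in a representation
by simple chains on pairwise disjoint open segments. (The sum does not depend on the
representation.) -/
def mass1 (Q : OneChain X G) : ℝ≥0∞ :=
  sInf {m | ∃ (n : ℕ) (g : Fin n → G) (x y : Fin n → X), NonOverlapping x y ∧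
    ∑ i, seg (x i) (y i) (g i) = Q ∧ m = ∑ i, simpleMass (g i) (x i) (y i)}

/-! Basic facts on mass, needed for the triangle inequality of the flat norm. -/

theorem boundary_seg (x y : X) (g : G) : boundary (seg x y g) = pt y g - pt x g :=
  boundaryFree_single x y g

theorem seg_self (x : X) (g : G) : seg x x g = 0 :=
  (QuotientAddGroup.eq_zero_iff _).2
    (AddSubgroup.subset_closure (Or.inl (Or.inl ⟨x, g, rfl⟩)))

theorem seg_swap (x y : X) (g : G) : seg y x g = seg x y (-g) := by
  have h : seg x y g + seg y x g = 0 :=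
    (QuotientAddGroup.eq_zero_iff _).2
      (AddSubgroup.subset_closure (Or.inl (Or.inr ⟨x, y, g, rfl⟩)))
  rw [map_neg]
  exact (neg_eq_of_add_eq_zero_right h).symm

theorem seg_split {x y z : X} (h : y ∈ openSegment ℝ x z) (g : G) :
    seg x z g = seg x y g + seg y z g := by
  have h : seg x z g - seg x y g - seg y z g = 0 :=
    (QuotientAddGroup.eq_zero_iff _).2
      (AddSubgroup.subset_closure (Or.inr ⟨x, y, z, g, h, rfl⟩))
  rw [← sub_eq_zero, ← h]; abel

theorem restrict0_pt (f : X → ℝ) (r : ℝ) (x : X) (g : G) :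
    restrict0 f r (pt x g) = if f x < r then pt x g else 0 := by
  split_ifs with h
  · exact Finsupp.filter_single_of_pos _ h
  · exact Finsupp.filter_single_of_neg _ h

theorem mass0_slice (f : X →L[ℝ] ℝ) (r : ℝ) (g : G) (x y : X) :
    mass0 (slice f r g x y) = (Set.uIoc (f x) (f y)).indicator (fun _ => ‖g‖ₑ) r := by
  by_cases hx : f x < r <;> by_cases hy : f y < r
  · rw [Set.indicator_of_notMem (by simp [Set.mem_uIoc, hx, hy])]
    simp [slice, portion, boundary_seg, restrict0_pt, hx, hy, mass0_zero]
  · rw [Set.indicator_of_mem (by simp [Set.mem_uIoc, hx, not_lt.1 hy])]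
    simp [slice, portion, boundary_seg, restrict0_pt, hx, hy, mass0_pt]
  · rw [Set.indicator_of_mem (by simp [Set.mem_uIoc, hy, not_lt.1 hx])]
    simp [slice, portion, boundary_seg, restrict0_pt, hx, hy, mass0_pt, mass0_neg]
  · rw [Set.indicator_of_notMem (by simp [Set.mem_uIoc, hx, hy])]
    simp [slice, portion, boundary_seg, restrict0_pt, hx, hy, mass0_zero]

theorem simpleMass_eq (g : G) (x y : X) : simpleMass g x y = ‖g‖ₑ * edist x y := by
  have key : ∀ f : X →L[ℝ] ℝ, ∫⁻ r : ℝ, mass0 (slice f r g x y)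
      = ‖g‖ₑ * ENNReal.ofReal |f y - f x| := by
    intro f
    simp_rw [mass0_slice]
    rw [lintegral_indicator_const measurableSet_uIoc, Real.volume_uIoc]
  have hd : edist x y = ENNReal.ofReal ‖y - x‖ := by
    rw [edist_dist, dist_comm, dist_eq_norm]
  simp only [simpleMass, key, hd]
  apply le_antisymm
  · refine iSup₂_le fun f hf => ?_
    gcongr
    rw [← map_sub, ← Real.norm_eq_abs]
    simpa [hf] using f.le_opNorm (y - x)
  · by_cases h : y - x = 0
    · simp [h]
    · obtain ⟨f, hf, hfv⟩ := exists_dual_vector ℝ (y - x) (norm_ne_zero_iff.2 h)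
      refine le_iSup₂_of_le f hf ?_
      rw [← map_sub, hfv]
      simp

/-- The chain with coefficient `c e` on each segment `e`, with a chosen orientation. -/
def chainOf (c : Sym2 X →₀ G) : OneChain X G :=
  c.sum fun e h => seg (Quot.out e).1 (Quot.out e).2 h

/-- The sum of coefficient norm times length. -/
def weight (c : Sym2 X →₀ G) : ℝ≥0∞ :=
  c.sum fun e h => ‖h‖ₑ * edist (Quot.out e).1 (Quot.out e).2

theorem chainOf_add (c d : Sym2 X →₀ G) : chainOf (c + d) = chainOf c + chainOf d := by
  classical
  exact Finsupp.sum_add_index' (by simp) (by simp)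

theorem weight_add_le (c d : Sym2 X →₀ G) : weight (c + d) ≤ weight c + weight d := by
  classical
  unfold weight
  rw [Finsupp.sum_of_support_subset c (Finset.subset_union_left (s₂ := d.support)) _ (by simp),
    Finsupp.sum_of_support_subset d (Finset.subset_union_right (s₁ := c.support)) _ (by simp),
    Finsupp.sum_of_support_subset (c + d) Finsupp.support_add _ (by simp),
    ← Finset.sum_add_distrib]
  refine Finset.sum_le_sum fun e _ => ?_
  rw [← add_mul]
  gcongr
  exact enorm_add_le _ _

theorem out_cases (a b : X) : Quot.out s(a, b) = (a, b) ∨ Quot.out s(a, b) = (b, a) := by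
  have h : s((Quot.out s(a, b)).1, (Quot.out s(a, b)).2) = s(a, b) := Quot.out_eq s(a, b)
  rw [Sym2.eq_iff] at h
  rcases h with ⟨h1, h2⟩ | ⟨h1, h2⟩
  · exact Or.inl (Prod.ext h1 h2)
  · exact Or.inr (Prod.ext h1 h2)

theorem openSegment_mono {x y p q : X} (hp : p ∈ segment ℝ x y) (hq : q ∈ segment ℝ x y)
    (hpq : p ≠ q) : openSegment ℝ p q ⊆ openSegment ℝ x y := by
  rw [segment_eq_image_lineMap] at hp hq
  obtain ⟨s, hs, rfl⟩ := hp
  obtain ⟨t, ht, rfl⟩ := hq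
  have hst : s ≠ t := fun h => hpq (by rw [h])
  rw [openSegment_eq_image_lineMap ℝ x y, ← image_openSegment, openSegment_eq_Ioo' hst]
  refine Set.image_mono (Set.Ioo_subset_Ioo ?_ ?_)
  · exact le_min hs.1 ht.1
  · exact max_le hs.2 ht.2

/-- A segment with end points in the finite set `V` is subdivided by the points of `V` on it. -/
theorem subdivide (V : Finset X) (g : G) : ∀ (n : ℕ) (x y : X), x ∈ V → y ∈ V →
    ((V : Set X) ∩ openSegment ℝ x y).ncard ≤ n → ∃ c : Sym2 X →₀ G,
      chainOf c = seg x y g ∧ weight c ≤ ‖g‖ₑ * edist x y ∧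
      ∀ e ∈ c.support, ∃ a b, e = s(a, b) ∧ a ≠ b ∧ a ∈ V ∧ b ∈ V ∧
        (∀ v ∈ V, v ∉ openSegment ℝ a b) ∧ a ∈ segment ℝ x y ∧ b ∈ segment ℝ x y := by
  classical
  intro n
  induction n with
  | zero =>
    intro x y hx hy hn
    by_cases hxy : x = y
    · subst hxy
      exact ⟨0, by simp [chainOf, seg_self], by simp [weight], by simp⟩
    have hfin : ((V : Set X) ∩ openSegment ℝ x y).Finite := V.finite_toSet.inter_of_left _
    have hemp : ∀ v ∈ V, v ∉ openSegment ℝ x y := by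
      intro v hv hv'
      have h0 := (Set.ncard_eq_zero hfin).1 (Nat.le_zero.1 hn)
      exact Set.notMem_empty v (h0 ▸ ⟨hv, hv'⟩)
    have hsupp : ∀ h : G, ∀ e ∈ (Finsupp.single s(x, y) h).support, ∃ a b, e = s(a, b) ∧ a ≠ b ∧
        a ∈ V ∧ b ∈ V ∧ (∀ v ∈ V, v ∉ openSegment ℝ a b) ∧
        a ∈ segment ℝ x y ∧ b ∈ segment ℝ x y := by
      intro h e he
      have := Finsupp.support_single_subset he
      exact ⟨x, y, Finset.mem_singleton.1 this, hxy, hx, hy, hemp,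
        left_mem_segment ℝ x y, right_mem_segment ℝ x y⟩
    rcases out_cases x y with ho | ho
    · refine ⟨Finsupp.single s(x, y) g, ?_, ?_, hsupp g⟩
      · rw [chainOf, Finsupp.sum_single_index (by simp), ho]
      · rw [weight, Finsupp.sum_single_index (by simp), ho]
    · refine ⟨Finsupp.single s(x, y) (-g), ?_, ?_, hsupp (-g)⟩
      · rw [chainOf, Finsupp.sum_single_index (by simp), ho, seg_swap, neg_neg]
      · rw [weight, Finsupp.sum_single_index (by simp), ho, enorm_neg, edist_comm]
  | succ n ih =>
    intro x y hx hy hn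
    by_cases hle : ((V : Set X) ∩ openSegment ℝ x y).ncard ≤ n
    · exact ih x y hx hy hle
    have hfin : ((V : Set X) ∩ openSegment ℝ x y).Finite := V.finite_toSet.inter_of_left _
    obtain ⟨p, hpV, hp⟩ : ((V : Set X) ∩ openSegment ℝ x y).Nonempty := by
      rw [Set.nonempty_iff_ne_empty]
      intro h
      rw [h] at hle
      simp at hle
    by_cases hxy : x = y
    · subst hxy
      exact ⟨0, by simp [chainOf, seg_self], by simp [weight], by simp⟩
    have hps : p ∈ segment ℝ x y := openSegment_subset_segment ℝ x y hp
    obtain ⟨t, ht, rfl⟩ := (openSegment_eq_image_lineMap ℝ x y) ▸ hp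
    set p := AffineMap.lineMap x y t with hpdef
    have hinj : Function.Injective (AffineMap.lineMap x y : ℝ → X) :=
      AffineMap.lineMap_injective ℝ hxy
    have hx0 : (AffineMap.lineMap x y (0 : ℝ) : X) = x := AffineMap.lineMap_apply_zero x y
    have hy1 : (AffineMap.lineMap x y (1 : ℝ) : X) = y := AffineMap.lineMap_apply_one x y
    have hxp : x ≠ p := fun h => ht.1.ne (hinj (hx0.trans h))
    have hpy : p ≠ y := fun h => ht.2.ne (hinj (h.trans hy1.symm))
    have n1 : p ∉ openSegment ℝ x p := fun h => hxp (right_mem_openSegment_iff.1 h)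
    have n2 : p ∉ openSegment ℝ p y := fun h => hpy (left_mem_openSegment_iff.1 h)
    have card : ∀ S ⊆ openSegment ℝ x y, p ∉ S → ((V : Set X) ∩ S).ncard ≤ n := by
      intro S hS hpS
      have : ((V : Set X) ∩ S).ncard < ((V : Set X) ∩ openSegment ℝ x y).ncard :=
        Set.ncard_lt_ncard ⟨Set.inter_subset_inter_right _ hS,
          fun h => hpS (h ⟨hpV, hp⟩).2⟩ hfin
      omega
    obtain ⟨c, c1, c2, c3⟩ := ih x p hx hpV
      (card _ (openSegment_mono (left_mem_segment ℝ x y) hps hxp) n1)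
    obtain ⟨d, d1, d2, d3⟩ := ih p y hpV hy
      (card _ (openSegment_mono hps (right_mem_segment ℝ x y) hpy) n2)
    refine ⟨c + d, ?_, ?_, ?_⟩
    · rw [chainOf_add, c1, d1, seg_split hp]
    · refine (weight_add_le c d).trans ((add_le_add c2 d2).trans ?_)
      rw [← mul_add]
      gcongr
      rw [edist_dist, edist_dist, edist_dist, ← ENNReal.ofReal_add dist_nonneg dist_nonneg,
        dist_add_dist_of_mem_segment hps]
    · intro e he
      rcases Finset.mem_union.1 (Finsupp.support_add he) with h | h
      · obtain ⟨a, b, h1, h2, h3, h4, h5, h6, h7⟩ := c3 e h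
        have hs := (convex_segment x y).segment_subset (left_mem_segment ℝ x y) hps
        exact ⟨a, b, h1, h2, h3, h4, h5, hs h6, hs h7⟩
      · obtain ⟨a, b, h1, h2, h3, h4, h5, h6, h7⟩ := d3 e h
        have hs := (convex_segment x y).segment_subset hps (right_mem_segment ℝ x y)
        exact ⟨a, b, h1, h2, h3, h4, h5, hs h6, hs h7⟩

theorem exists_lineMap {x y p q a : X} (hp : p ∈ segment ℝ x y) (hq : q ∈ segment ℝ x y)
    (ha : a ∈ segment ℝ x y) (hpq : p ≠ q) : ∃ t : ℝ, AffineMap.lineMap p q t = a := by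
  rw [segment_eq_image_lineMap] at hp hq ha
  obtain ⟨s, -, rfl⟩ := hp
  obtain ⟨t, -, rfl⟩ := hq
  obtain ⟨u, -, rfl⟩ := ha
  have hst : t - s ≠ 0 := fun h => hpq (by rw [sub_eq_zero.1 h])
  refine ⟨(u - s) / (t - s), ?_⟩
  rw [← AffineMap.apply_lineMap]
  congr 1
  rw [AffineMap.lineMap_apply_ring', div_mul_cancel₀ _ hst, sub_add_cancel]

theorem real_openSegment_eq {a b c d u : ℝ} (hab : a ≠ b) (hcd : c ≠ d)
    (h1 : u ∈ openSegment ℝ a b) (h2 : u ∈ openSegment ℝ c d)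
    (hc : c ∉ openSegment ℝ a b) (hd : d ∉ openSegment ℝ a b)
    (ha : a ∉ openSegment ℝ c d) (hb : b ∉ openSegment ℝ c d) :
    (a = c ∧ b = d) ∨ (a = d ∧ b = c) := by
  simp only [openSegment_eq_Ioo' hab, openSegment_eq_Ioo' hcd] at *
  grind

theorem disjoint_pieces {x y x' y' a b a' b' : X} {V : Finset X}
    (hV : ∀ p, segment ℝ x y ∩ segment ℝ x' y' = {p} → p ∈ V)
    (hab : a ≠ b) (ha : a ∈ segment ℝ x y) (hb : b ∈ segment ℝ x y)
    (haV : a ∈ V) (hbV : b ∈ V) (hV1 : ∀ v ∈ V, v ∉ openSegment ℝ a b)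
    (hab' : a' ≠ b') (ha' : a' ∈ segment ℝ x' y') (hb' : b' ∈ segment ℝ x' y')
    (haV' : a' ∈ V) (hbV' : b' ∈ V) (hV2 : ∀ v ∈ V, v ∉ openSegment ℝ a' b')
    (hne : s(a, b) ≠ s(a', b')) :
    Disjoint (openSegment ℝ a b) (openSegment ℝ a' b') := by
  rw [Set.disjoint_left]
  intro p hp hp'
  have hpx : p ∈ segment ℝ x y :=
    (convex_segment x y).segment_subset ha hb (openSegment_subset_segment ℝ a b hp)
  have hpx' : p ∈ segment ℝ x' y' :=
    (convex_segment x' y').segment_subset ha' hb' (openSegment_subset_segment ℝ a' b' hp')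
  by_cases hq : ∃ q ∈ segment ℝ x y ∩ segment ℝ x' y', p ≠ q
  · obtain ⟨q, ⟨hq, hq'⟩, hpq⟩ := hq
    obtain ⟨s, rfl⟩ := exists_lineMap hpx hq ha hpq
    obtain ⟨t, rfl⟩ := exists_lineMap hpx hq hb hpq
    obtain ⟨s', rfl⟩ := exists_lineMap hpx' hq' ha' hpq
    obtain ⟨t', rfl⟩ := exists_lineMap hpx' hq' hb' hpq
    have hinj : Function.Injective (AffineMap.lineMap p q : ℝ → X) :=
      AffineMap.lineMap_injective ℝ hpq
    have hmem : ∀ u v w : ℝ, (AffineMap.lineMap p q w : X) ∈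
        openSegment ℝ (AffineMap.lineMap p q u : X) (AffineMap.lineMap p q v) ↔
        w ∈ openSegment ℝ u v := by
      intro u v w
      rw [← image_openSegment, hinj.mem_set_image]
    have hp0 : (AffineMap.lineMap p q (0 : ℝ) : X) = p := AffineMap.lineMap_apply_zero p q
    have n1 := hV1 _ haV'
    have n2 := hV1 _ hbV'
    have n3 := hV2 _ haV
    have n4 := hV2 _ hbV
    have m1 : (AffineMap.lineMap p q (0 : ℝ) : X) ∈
      openSegment ℝ (AffineMap.lineMap p q s : X) (AffineMap.lineMap p q t) := by rwa [hp0]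
    have m2 : (AffineMap.lineMap p q (0 : ℝ) : X) ∈
      openSegment ℝ (AffineMap.lineMap p q s' : X) (AffineMap.lineMap p q t') := by rwa [hp0]
    rw [hmem] at n1 n2 n3 n4 m1 m2
    rcases real_openSegment_eq (fun h => hab (by rw [h])) (fun h => hab' (by rw [h]))
      m1 m2 n1 n2 n3 n4 with ⟨rfl, rfl⟩ | ⟨rfl, rfl⟩
    · exact hne rfl
    · exact hne Sym2.eq_swap
  · push Not at hq
    refine hV1 p (hV p ?_) hp
    ext z
    constructor
    · intro hz
      exact (hq z hz).symm
    · rintro rfl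
      exact ⟨hpx, hpx'⟩

/-- The mass of a sum of simple chains is at most the sum of their masses. -/
theorem mass1_sum_le {ι : Type*} [Fintype ι] (g : ι → G) (x y : ι → X) :
    mass1 (∑ i, seg (x i) (y i) (g i)) ≤ ∑ i, simpleMass (g i) (x i) (y i) := by
  classical
  let C : Set X := ⋃ i, ⋃ j, {p | segment ℝ (x i) (y i) ∩ segment ℝ (x j) (y j) = {p}}
  have hC : C.Finite := by
    refine Set.finite_iUnion fun i => Set.finite_iUnion fun j => Set.Subsingleton.finite ?_
    intro p hp q hq
    exact Set.singleton_injective (hp.symm.trans hq)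
  let V : Finset X := Finset.univ.image x ∪ Finset.univ.image y ∪ hC.toFinset
  have hxV : ∀ i, x i ∈ V := fun i => by simp [V]
  have hyV : ∀ i, y i ∈ V := fun i => by simp [V]
  have hCV : ∀ i j p, segment ℝ (x i) (y i) ∩ segment ℝ (x j) (y j) = {p} → p ∈ V := by
    intro i j p h
    refine Finset.mem_union_right _ (hC.mem_toFinset.2 ?_)
    exact Set.mem_iUnion.2 ⟨i, Set.mem_iUnion.2 ⟨j, h⟩⟩
  choose c c1 c2 c3 using fun i => subdivide V (g i) _ (x i) (y i) (hxV i) (hyV i) le_rfl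
  have hsum : ∀ s : Finset ι, chainOf (∑ i ∈ s, c i) = ∑ i ∈ s, seg (x i) (y i) (g i) ∧
      weight (∑ i ∈ s, c i) ≤ ∑ i ∈ s, simpleMass (g i) (x i) (y i) := by
    intro s
    induction s using Finset.induction_on with
    | empty => simp [chainOf, weight]
    | insert i s hi ih =>
      rw [Finset.sum_insert hi, Finset.sum_insert hi, Finset.sum_insert hi, chainOf_add, c1, ih.1]
      refine ⟨rfl, (weight_add_le _ _).trans (add_le_add ?_ ih.2)⟩
      rw [simpleMass_eq]
      exact c2 i
  obtain ⟨h1, h2⟩ := hsum Finset.univ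
  set d := ∑ i, c i with hd
  have hsupp : ∀ e ∈ d.support, ∃ i, e ∈ (c i).support := by
    intro e he
    have := Finsupp.support_finsetSum he
    simpa using this
  refine le_trans ?_ h2
  refine sInf_le ?_
  let φ := d.support.equivFin
  have o : ∀ (e : Sym2 X), s((Quot.out e).1, (Quot.out e).2) = e := fun e => Quot.out_eq e
  have key : ∀ e ∈ d.support, ∃ i, (Quot.out e).1 ≠ (Quot.out e).2 ∧ (Quot.out e).1 ∈ V ∧
      (Quot.out e).2 ∈ V ∧ (∀ v ∈ V, v ∉ openSegment ℝ (Quot.out e).1 (Quot.out e).2) ∧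
      (Quot.out e).1 ∈ segment ℝ (x i) (y i) ∧ (Quot.out e).2 ∈ segment ℝ (x i) (y i) := by
    intro e he
    obtain ⟨i, hi⟩ := hsupp e he
    obtain ⟨a, b, rfl, k2, k3, k4, k5, k6, k7⟩ := c3 i e hi
    refine ⟨i, ?_⟩
    rcases out_cases a b with ho | ho <;> rw [ho]
    · exact ⟨k2, k3, k4, k5, k6, k7⟩
    · refine ⟨k2.symm, k4, k3, ?_, k7, k6⟩
      rwa [openSegment_symm]
  refine ⟨d.support.card, fun k => d (φ.symm k), fun k => (Quot.out (φ.symm k : Sym2 X)).1,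
    fun k => (Quot.out (φ.symm k : Sym2 X)).2, ⟨?_, ?_⟩, ?_, ?_⟩
  · intro k
    obtain ⟨i, hi, -⟩ := key _ (φ.symm k).2
    exact hi
  · intro k l hkl
    obtain ⟨i, i1, i2, i3, i4, i5, i6⟩ := key _ (φ.symm k).2
    obtain ⟨j, j1, j2, j3, j4, j5, j6⟩ := key _ (φ.symm l).2
    refine disjoint_pieces (hCV i j) i1 i5 i6 i2 i3 i4 j1 j5 j6 j2 j3 j4 ?_
    rw [o, o]
    intro h
    exact hkl (φ.symm.injective (Subtype.ext h))
  · rw [← h1, chainOf, Finsupp.sum, ← Finset.sum_coe_sort d.support]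
    exact φ.symm.sum_comp fun e : d.support =>
      seg (Quot.out (e : Sym2 X)).1 (Quot.out (e : Sym2 X)).2 (d e)
  · simp only [simpleMass_eq]
    rw [weight, Finsupp.sum, ← Finset.sum_coe_sort d.support]
    exact (φ.symm.sum_comp fun e : d.support =>
      ‖d e‖ₑ * edist (Quot.out (e : Sym2 X)).1 (Quot.out (e : Sym2 X)).2).symm

theorem mass1_zero : mass1 (0 : OneChain X G) = 0 := by
  have h := mass1_sum_le (fun i : Fin 0 => (0 : G)) (fun _ => (0 : X)) (fun _ => (0 : X))
  simpa using h

theorem mass1_add_le (P Q : OneChain X G) : mass1 (P + Q) ≤ mass1 P + mass1 Q := by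
  rw [mass1.eq_def P, mass1.eq_def Q, sInf_eq_iInf', sInf_eq_iInf']
  refine ENNReal.le_iInf_add_iInf ?_
  rintro ⟨_, n, g, x, y, -, rfl, rfl⟩ ⟨_, n', g', x', y', -, rfl, rfl⟩
  have h := mass1_sum_le (Sum.elim g g') (Sum.elim x x') (Sum.elim y y')
  simpa using h

theorem mass1_neg_le (P : OneChain X G) : mass1 (-P) ≤ mass1 P := by
  refine le_sInf ?_
  rintro _ ⟨n, g, x, y, h, rfl, rfl⟩
  refine sInf_le ⟨n, fun i => -g i, x, y, h, by simp, by simp [simpleMass_eq]⟩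

end One

/-! ### The flat norm and flat `0`-chains -/

section Flat

variable {X G : Type*} [NormedAddCommGroup X] [NormedSpace ℝ X] [NormedAddCommGroup G]

/-- `inf_Q M(Q) + M(∂Q - P)` over polyhedral `1`-chains `Q`, in `[0, ∞]`. -/
def flatENorm (P : ZeroChain X G) : ℝ≥0∞ :=
  ⨅ Q : OneChain X G, mass1 Q + mass0 (boundary Q - P)

/-- The flat norm `F(P)`; the infimum is finite, see `flatENorm_ne_top`. -/
def flatNorm (P : ZeroChain X G) : ℝ := (flatENorm P).toReal

theorem flatENorm_le_mass0 (P : ZeroChain X G) : flatENorm P ≤ mass0 P := by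
  refine (iInf_le _ 0).trans ?_
  simp [mass1_zero, mass0_neg]

theorem flatENorm_ne_top (P : ZeroChain X G) : flatENorm P ≠ ∞ :=
  ne_top_of_le_ne_top (mass0_ne_top P) (flatENorm_le_mass0 P)

theorem flatENorm_add_le (P Q : ZeroChain X G) :
    flatENorm (P + Q) ≤ flatENorm P + flatENorm Q := by
  refine ENNReal.le_iInf_add_iInf ?_
  intro R S
  refine (iInf_le _ (R + S)).trans ?_
  have e : boundary (R + S) - (P + Q) = (boundary R - P) + (boundary S - Q) := by
    rw [map_add]; abel
  rw [e, add_add_add_comm]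
  exact add_le_add (mass1_add_le R S) (mass0_add_le _ _)

theorem flatENorm_neg_le (P : ZeroChain X G) : flatENorm (-P) ≤ flatENorm P := by
  refine le_iInf fun R => (iInf_le _ (-R)).trans ?_
  have e : boundary (-R) - -P = -(boundary R - P) := by rw [map_neg]; abel
  rw [e, mass0_neg]
  gcongr
  exact mass1_neg_le R

/-- Polyhedral `0`-chains carry the flat norm. -/
instance : SeminormedAddCommGroup (ZeroChain X G) :=
  AddGroupSeminorm.toSeminormedAddCommGroup
    { toFun := flatNorm
      map_zero' := by
        have h := flatENorm_le_mass0 (0 : ZeroChain X G)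
        rw [mass0_zero, nonpos_iff_eq_zero] at h
        simp [flatNorm, h]
      add_le' := fun P Q => by
        rw [flatNorm, flatNorm, flatNorm,
          ← ENNReal.toReal_add (flatENorm_ne_top P) (flatENorm_ne_top Q)]
        exact ENNReal.toReal_mono
          (ENNReal.add_ne_top.2 ⟨flatENorm_ne_top P, flatENorm_ne_top Q⟩) (flatENorm_add_le P Q)
      neg' := fun P => by
        refine congrArg ENNReal.toReal (le_antisymm (flatENorm_neg_le P) ?_)
        simpa using flatENorm_neg_le (-P) }

theorem norm_eq_flatNorm (P : ZeroChain X G) : ‖P‖ = flatNorm P := rfl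

variable (X G) in
/-- Flat `0`-chains: the completion of the polyhedral `0`-chains in the flat norm. -/
abbrev FlatZeroChain : Type _ := UniformSpace.Completion (ZeroChain X G)

/-- The mass of a flat `0`-chain `A`: the smallest `m ∈ [0, ∞]` such that some sequence of
polyhedral chains converges to `A` with masses converging to `m`. -/
def mass (A : FlatZeroChain X G) : ℝ≥0∞ :=
  sInf {m | ∃ P : ℕ → ZeroChain X G,
    Tendsto (fun i => (P i : FlatZeroChain X G)) atTop (𝓝 A) ∧
    Tendsto (fun i => mass0 (P i)) atTop (𝓝 m)}

/-- The polyhedral chains `P i` converge rapidly to `A`: `∑ F(P i - A) < ∞`. -/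
def ConvergesRapidly (P : ℕ → ZeroChain X G) (A : FlatZeroChain X G) : Prop :=
  Summable fun i => ‖(P i : FlatZeroChain X G) - A‖

/-- For a sequence `P` converging rapidly to a flat chain `A`: the value `r` is not exceptional
for `P` and `f`, and the restriction `A ⌞ f⁻¹((-∞, r)) = lim P i ⌞ f⁻¹((-∞, r))` is `B`. -/
def IsRestriction (P : ℕ → ZeroChain X G) (f : X → ℝ) (r : ℝ) (B : FlatZeroChain X G) : Prop :=
  (Summable fun i => ‖restrict0 f r (P (i + 1) - P i)‖) ∧
    Tendsto (fun i => (restrict0 f r (P i) : FlatZeroChain X G)) atTop (𝓝 B)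

/-- The support of a flat `0`-chain `A`: the points `x` for which there are non-exceptional
`r j ↓ 0` with `F(A ⌞ B(x, r j)) > 0` for all `j`. Restrictions of `A` are defined for almost
every radius only, through a rapidly converging sequence of polyhedral chains; the radii must
exist whichever sequence is used. -/
def spt (A : FlatZeroChain X G) : Set X :=
  {x | ∀ P : ℕ → ZeroChain X G, ConvergesRapidly P A →
    ∃ r : ℕ → ℝ, StrictAnti r ∧ (∀ j, 0 < r j) ∧ Tendsto r atTop (𝓝 0) ∧
      ∀ j, ∃ B : FlatZeroChain X G, IsRestriction P (fun z => dist z x) (r j) B ∧ 0 < ‖B‖}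

end Flat

end FlatChain

end

/-! A flat chain `A` of finite mass has a recovery sequence: polyhedral chains `P i → A`, rapidly,
with `M(P i) → M(A)`. If portions of the `P i` converge to `A` as well, lower semicontinuity of the
mass leaves no mass for the complementary portions. Slicing by a Lipschitz function costs, on
average over the level, only a multiple of the flat norm. Slicing by the distance to the atoms of
one `P i`, which is close to all later ones in the flat norm, shows that up to `ε` the mass of the
later ones lies within `η` of that finite set. Completeness of `X` then provides a cluster point in
every closed set that keeps a positive amount of mass, and slicing by the distance to a cluster
point shows that it belongs to the support. So the mass concentrates near `spt A`, and pushing the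
remaining atoms into the support gives polyhedral chains in `spt A` near `A`. Moving the atoms of
such a chain to a finite net changes its flat norm by at most its mass times the mesh, and only
finitely many coefficients in a totally bounded ball of `G` remain. -/

namespace FlatChain

section Portion

variable {X G : Type*} [NormedAddCommGroup G]

/-- The coefficients of a `0`-chain, as a finitely supported function on the space. -/
def coeff (P : ZeroChain X G) : X →₀ G := P

open Classical in
/-- The portion `P ⌞ E` of a `0`-chain `P` in an arbitrary set `E`. -/
noncomputable def portionIn (E : Set X) : ZeroChain X G →+ ZeroChain X G :=
  Finsupp.filterAddHom (· ∈ E)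

/-- The mass measure `‖P‖` of a `0`-chain `P`: its value at `E` is the mass of `P ⌞ E`. It is an
outer measure, so that no `σ`-algebra on `X` has to be chosen. -/
noncomputable def massMeasure (P : ZeroChain X G) : OuterMeasure X :=
  (coeff P).sum fun x g => ‖g‖ₑ • OuterMeasure.dirac x

theorem sum_pt_coeff (P : ZeroChain X G) : (coeff P).sum (fun x g => pt x g) = P :=
  Finsupp.sum_single (coeff P)

theorem mass0_eq_sum (P : ZeroChain X G) : mass0 P = (coeff P).sum fun _ g => ‖g‖ₑ := rfl

theorem enorm_coeff_le_mass0 (P : ZeroChain X G) (x : X) : ‖coeff P x‖ₑ ≤ mass0 P := by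
  by_cases hx : x ∈ (coeff P).support
  · exact Finset.single_le_sum_of_canonicallyOrdered (f := fun x => ‖coeff P x‖ₑ) hx
  · simp [Finsupp.notMem_support_iff.1 hx]

open Classical in
theorem coeff_portionIn (E : Set X) (P : ZeroChain X G) :
    coeff (portionIn E P) = (coeff P).filter (· ∈ E) := rfl

theorem restrict0_eq_portionIn (f : X → ℝ) (r : ℝ) :
    restrict0 (G := G) f r = portionIn {x | f x < r} := by
  unfold restrict0 portionIn
  congr!

theorem support_portionIn_subset (E : Set X) (P : ZeroChain X G) :
    ↑(coeff (portionIn E P)).support ⊆ E := by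
  rw [coeff_portionIn, Finsupp.support_filter, Finset.coe_filter]
  exact fun _ hx => hx.2

theorem portionIn_eq_self {E : Set X} {P : ZeroChain X G} (h : ↑(coeff P).support ⊆ E) :
    portionIn E P = P := by
  classical
  exact (Finsupp.filter_eq_self_iff (· ∈ E) (coeff P)).2 fun x hx =>
    h (Finsupp.mem_support_iff.2 hx)

theorem portionIn_add_portionIn_compl (E : Set X) (P : ZeroChain X G) :
    portionIn E P + portionIn Eᶜ P = P := by
  classical
  change coeff (portionIn E P) + coeff (portionIn Eᶜ P) = coeff P
  simp only [coeff_portionIn, Set.mem_compl_iff]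
  exact Finsupp.filter_add_filter_not (coeff P) (· ∈ E)

theorem massMeasure_apply (P : ZeroChain X G) (E : Set X) :
    massMeasure P E = (coeff P).sum fun x g => E.indicator (fun _ => ‖g‖ₑ) x := by
  simp [massMeasure, Finsupp.sum, Set.indicator]

theorem mass0_portionIn (E : Set X) (P : ZeroChain X G) :
    mass0 (portionIn E P) = massMeasure P E := by
  classical
  rw [mass0_eq_sum, coeff_portionIn, Finsupp.sum_filter_index, Finsupp.support_filter,
    Finset.sum_filter, massMeasure_apply]
  rfl

theorem massMeasure_add_massMeasure_compl (P : ZeroChain X G) (E : Set X) :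
    massMeasure P E + massMeasure P Eᶜ = mass0 P := by
  rw [massMeasure_apply, massMeasure_apply, ← Finsupp.sum_add, mass0_eq_sum]
  refine Finset.sum_congr rfl fun x _ => ?_
  exact congrFun (Set.indicator_self_add_compl E fun _ => ‖coeff P x‖ₑ) x

theorem mass0_portionIn_le (E : Set X) (P : ZeroChain X G) : mass0 (portionIn E P) ≤ mass0 P := by
  rw [mass0_portionIn, ← massMeasure_add_massMeasure_compl P E]
  exact le_self_add

end Portion

section Slicing

variable {X G : Type*} [NormedAddCommGroup X] [NormedSpace ℝ X] [NormedAddCommGroup G]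

theorem enorm_eq_flatENorm (P : ZeroChain X G) : ‖P‖ₑ = flatENorm P := by
  rw [← ofReal_norm, norm_eq_flatNorm, flatNorm, ENNReal.ofReal_toReal (flatENorm_ne_top P)]

theorem enorm_le_mass0 (P : ZeroChain X G) : ‖P‖ₑ ≤ mass0 P :=
  (enorm_eq_flatENorm P).trans_le (flatENorm_le_mass0 P)

theorem enorm_zeroChain_zero : ‖(0 : ZeroChain X G)‖ₑ = 0 :=
  nonpos_iff_eq_zero.1 ((enorm_le_mass0 0).trans_eq mass0_zero)

theorem enorm_zeroChain_add_le (P Q : ZeroChain X G) : ‖P + Q‖ₑ ≤ ‖P‖ₑ + ‖Q‖ₑ := by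
  simpa only [enorm_eq_flatENorm] using flatENorm_add_le P Q

theorem enorm_zeroChain_sum_le {ι : Type*} (s : Finset ι) (P : ι → ZeroChain X G) :
    ‖∑ i ∈ s, P i‖ₑ ≤ ∑ i ∈ s, ‖P i‖ₑ :=
  Finset.le_sum_of_subadditive (‖·‖ₑ) enorm_zeroChain_zero.le enorm_zeroChain_add_le s P

theorem enorm_pt_sub_pt_le (g : G) (x y : X) : ‖pt y g - pt x g‖ₑ ≤ ‖g‖ₑ * edist x y := by
  rw [enorm_eq_flatENorm]
  refine (iInf_le _ (seg x y g)).trans ?_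
  rw [boundary_seg, sub_self, mass0_zero, add_zero, ← simpleMass_eq]
  simpa using mass1_sum_le (fun _ : Unit => g) (fun _ => x) (fun _ => y)

theorem measurable_comp_restrict0 {β : Type*} [MeasurableSpace β] (f : X → ℝ)
    (h : ZeroChain X G → β) (P : ZeroChain X G) : Measurable fun r => h (restrict0 f r P) := by
  induction P using Finsupp.induction generalizing h with
  | zero =>
    have h0 (r : ℝ) : h (restrict0 f r (0 : X →₀ G)) = h 0 := congrArg h (map_zero _)
    simp only [h0, measurable_const]
  | single_add x g P _ _ ih =>
    have hP (r : ℝ) : h (restrict0 f r (Finsupp.single x g + P)) =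
        if f x < r then h (pt x g + restrict0 f r P) else h (restrict0 f r P) := by
      refine (congrArg h (map_add (restrict0 f r) (pt x g) P)).trans ?_
      rw [restrict0_pt]
      split_ifs
      · rfl
      · rw [zero_add]
    have hs : MeasurableSet {r | f x < r} := measurableSet_Ioi
    simpa only [hP] using Measurable.ite hs (ih fun Q => h (pt x g + Q)) (ih h)

theorem enorm_restrict0_pt_sub_pt_le (f : X → ℝ) (r : ℝ) (g : G) (x y : X) :
    ‖restrict0 f r (pt y g - pt x g)‖ₑ ≤
      ‖g‖ₑ * edist x y + (Set.uIoc (f x) (f y)).indicator (fun _ => ‖g‖ₑ) r := by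
  rw [map_sub, restrict0_pt, restrict0_pt]
  by_cases hx : f x < r <;> by_cases hy : f y < r
  · simpa [hx, hy] using (enorm_pt_sub_pt_le g x y).trans le_self_add
  · have hr : r ∈ Set.uIoc (f x) (f y) := Set.mem_uIoc.2 (.inl ⟨hx, not_lt.1 hy⟩)
    rw [Set.indicator_of_mem hr]
    simpa [hx, hy, mass0_pt] using (enorm_le_mass0 (pt x g)).trans le_add_self
  · have hr : r ∈ Set.uIoc (f x) (f y) := Set.mem_uIoc.2 (.inr ⟨hy, not_lt.1 hx⟩)
    rw [Set.indicator_of_mem hr]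
    simpa [hx, hy, mass0_pt] using (enorm_le_mass0 (pt y g)).trans le_add_self
  · simp [hx, hy, enorm_zeroChain_zero]

theorem lintegral_enorm_restrict0_pt_sub_pt_le {f : X → ℝ} {K : ℝ≥0} (hf : LipschitzWith K f)
    (s : Set ℝ) (g : G) (x y : X) :
    ∫⁻ r in s, ‖restrict0 f r (pt y g - pt x g)‖ₑ ≤ (volume s + K) * (‖g‖ₑ * edist x y) := by
  calc ∫⁻ r in s, ‖restrict0 f r (pt y g - pt x g)‖ₑ
    _ ≤ ∫⁻ r in s, (‖g‖ₑ * edist x y + (Set.uIoc (f x) (f y)).indicator (fun _ => ‖g‖ₑ) r) :=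
        lintegral_mono fun r => enorm_restrict0_pt_sub_pt_le f r g x y
    _ ≤ ‖g‖ₑ * edist x y * volume s + ‖g‖ₑ * edist (f x) (f y) := by
        rw [lintegral_add_left measurable_const, setLIntegral_const]
        gcongr
        refine (setLIntegral_le_lintegral _ _).trans_eq ?_
        rw [lintegral_indicator_const measurableSet_uIoc, Real.volume_uIoc, ← Real.dist_eq,
          ← edist_dist, edist_comm]
    _ ≤ ‖g‖ₑ * edist x y * volume s + ‖g‖ₑ * (K * edist x y) := by
        gcongr
        exact hf x y
    _ = (volume s + K) * (‖g‖ₑ * edist x y) := by ring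

theorem lintegral_enorm_restrict0_boundary_le {f : X → ℝ} {K : ℝ≥0} (hf : LipschitzWith K f)
    {s : Set ℝ} (hs : volume s ≠ ∞) (Q : OneChain X G) :
    ∫⁻ r in s, ‖restrict0 f r (boundary Q)‖ₑ ≤ (volume s + K) * mass1 Q := by
  rcases eq_or_ne (volume s) 0 with h0 | h0
  · rw [setLIntegral_measure_zero s _ h0]
    exact zero_le
  rw [mass1, sInf_eq_iInf', ENNReal.mul_iInf_of_ne (by simp [h0]) (by simp [hs])]
  refine le_iInf ?_
  rintro ⟨_, n, g, x, y, -, rfl, rfl⟩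
  simp only [simpleMass_eq, map_sum, boundary_seg, Finset.mul_sum]
  calc ∫⁻ r in s, ‖∑ i, restrict0 f r (pt (y i) (g i) - pt (x i) (g i))‖ₑ
    _ ≤ ∫⁻ r in s, ∑ i, ‖restrict0 f r (pt (y i) (g i) - pt (x i) (g i))‖ₑ :=
        lintegral_mono fun r => enorm_zeroChain_sum_le _ _
    _ = ∑ i, ∫⁻ r in s, ‖restrict0 f r (pt (y i) (g i) - pt (x i) (g i))‖ₑ :=
        lintegral_finsetSum _ fun i _ => measurable_comp_restrict0 f (‖·‖ₑ) _
    _ ≤ ∑ i, (volume s + K) * (‖g i‖ₑ * edist (x i) (y i)) :=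
        Finset.sum_le_sum fun i _ => lintegral_enorm_restrict0_pt_sub_pt_le hf s _ _ _

theorem lintegral_enorm_restrict0_le {f : X → ℝ} {K : ℝ≥0} (hf : LipschitzWith K f)
    {s : Set ℝ} (hs : volume s ≠ ∞) (P : ZeroChain X G) :
    ∫⁻ r in s, ‖restrict0 f r P‖ₑ ≤ (volume s + K) * ‖P‖ₑ := by
  rcases eq_or_ne (volume s) 0 with h0 | h0
  · rw [setLIntegral_measure_zero s _ h0]
    exact zero_le
  rw [enorm_eq_flatENorm, flatENorm, ENNReal.mul_iInf_of_ne (by simp [h0]) (by simp [hs])]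
  refine le_iInf fun Q => ?_
  have hR (r : ℝ) : ‖restrict0 f r (boundary Q - P)‖ₑ ≤ mass0 (boundary Q - P) :=
    (enorm_le_mass0 _).trans (restrict0_eq_portionIn (G := G) f r ▸ mass0_portionIn_le _ _)
  calc ∫⁻ r in s, ‖restrict0 f r P‖ₑ
    _ ≤ ∫⁻ r in s, (‖restrict0 f r (boundary Q)‖ₑ + mass0 (boundary Q - P)) := by
        refine lintegral_mono fun r => ?_
        calc ‖restrict0 f r P‖ₑ
          _ = ‖restrict0 f r (boundary Q) - restrict0 f r (boundary Q - P)‖ₑ := by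
              rw [← map_sub, sub_sub_cancel]
          _ ≤ _ := enorm_sub_le.trans (add_le_add_right (hR r) _)
    _ = (∫⁻ r in s, ‖restrict0 f r (boundary Q)‖ₑ) + mass0 (boundary Q - P) * volume s := by
        rw [lintegral_add_right _ measurable_const, setLIntegral_const]
    _ ≤ (volume s + K) * mass1 Q + mass0 (boundary Q - P) * (volume s + K) := by
        gcongr
        · exact lintegral_enorm_restrict0_boundary_le hf hs Q
        · exact le_self_add
    _ = (volume s + K) * (mass1 Q + mass0 (boundary Q - P)) := by ring

theorem ae_summable_norm_restrict0 {f : X → ℝ} {K : ℝ≥0} (hf : LipschitzWith K f)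
    {P : ℕ → ZeroChain X G} (hP : Summable fun i => ‖P i‖) :
    ∀ᵐ r, Summable fun i => ‖restrict0 f r (P i)‖ := by
  refine ae_of_forall_measure_lt_top_ae_restrict _ fun s _ hs => ?_
  have hmeas (i : ℕ) : Measurable fun r => ‖restrict0 f r (P i)‖ₑ :=
    measurable_comp_restrict0 f (‖·‖ₑ) (P i)
  have hfin : ∫⁻ r in s, ∑' i, ‖restrict0 f r (P i)‖ₑ ≠ ∞ := by
    rw [lintegral_tsum fun i => (hmeas i).aemeasurable]
    refine ne_top_of_le_ne_top ?_
      (ENNReal.tsum_le_tsum fun i => lintegral_enorm_restrict0_le hf hs.ne (P i))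
    rw [ENNReal.tsum_mul_left]
    exact ENNReal.mul_ne_top (by simp [hs.ne]) (by simpa using hP.tsum_ofReal_ne_top)
  filter_upwards [ae_lt_top (Measurable.tsum hmeas) hfin] with r hr
  simpa using ENNReal.summable_toReal hr.ne

theorem ConvergesRapidly.tendsto {P : ℕ → ZeroChain X G} {A : FlatZeroChain X G}
    (hP : ConvergesRapidly P A) : Tendsto (fun i => (P i : FlatZeroChain X G)) atTop (𝓝 A) :=
  tendsto_iff_norm_sub_tendsto_zero.2 hP.tendsto_atTop_zero

theorem ConvergesRapidly.summable_norm_sub {P Q : ℕ → ZeroChain X G} {A : FlatZeroChain X G}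
    (hP : ConvergesRapidly P A) (hQ : ConvergesRapidly Q A) : Summable fun i => ‖P i - Q i‖ := by
  refine (Summable.add hP hQ).of_nonneg_of_le (fun _ => norm_nonneg _) fun i => ?_
  rw [← UniformSpace.Completion.norm_coe, UniformSpace.Completion.coe_sub,
    ← sub_sub_sub_cancel_right _ _ A]
  exact norm_sub_le _ _

theorem ConvergesRapidly.comp_succ {P : ℕ → ZeroChain X G} {A : FlatZeroChain X G}
    (hP : ConvergesRapidly P A) : ConvergesRapidly (fun i => P (i + 1)) A :=
  (summable_nat_add_iff 1).2 hP

theorem ConvergesRapidly.ae_exists_isRestriction {P Q : ℕ → ZeroChain X G} {A : FlatZeroChain X G}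
    (hP : ConvergesRapidly P A) (hQ : ConvergesRapidly Q A) {f : X → ℝ} {K : ℝ≥0}
    (hf : LipschitzWith K f) : ∀ᵐ r, ∃ B, IsRestriction P f r B ∧ IsRestriction Q f r B := by
  filter_upwards [ae_summable_norm_restrict0 hf (hP.comp_succ.summable_norm_sub hP),
    ae_summable_norm_restrict0 hf (hQ.comp_succ.summable_norm_sub hQ),
    ae_summable_norm_restrict0 hf (hP.summable_norm_sub hQ)] with r hr hr' hr''
  have hcauchy : CauchySeq fun i => (restrict0 f r (Q i) : FlatZeroChain X G) := by
    refine cauchySeq_of_summable_dist (hr'.congr fun i => ?_)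
    rw [dist_comm, UniformSpace.Completion.dist_eq, dist_eq_norm, map_sub]
  obtain ⟨B, hB⟩ := cauchySeq_tendsto_of_complete hcauchy
  refine ⟨B, ⟨hr, ?_⟩, hr', hB⟩
  have hPQ : Tendsto (fun i => (restrict0 f r (P i - Q i) : FlatZeroChain X G)) atTop (𝓝 0) := by
    rw [tendsto_zero_iff_norm_tendsto_zero]
    simpa only [UniformSpace.Completion.norm_coe] using hr''.tendsto_atTop_zero
  simpa [map_sub, UniformSpace.Completion.coe_sub] using hPQ.add hB

theorem exists_norm_restrict0_le {f : X → ℝ} {K : ℝ≥0} (hf : LipschitzWith K f)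
    (P : ZeroChain X G) {η : ℝ} (hη : 0 < η) :
    ∃ r ∈ Set.Ioo 0 η, ‖restrict0 f r P‖ ≤ (η + K) * ‖P‖ / η := by
  have hv : volume (Set.Ioo 0 η) = ENNReal.ofReal η := by rw [Real.volume_Ioo, sub_zero]
  obtain ⟨r, hr, hle⟩ := exists_le_setLAverage (μ := volume) (s := Set.Ioo 0 η)
    (by simpa [hv] using hη) (by simp [hv])
    (measurable_comp_restrict0 f (‖·‖ₑ) P).aemeasurable
  refine ⟨r, hr, ?_⟩
  have hbound : ‖restrict0 f r P‖ₑ ≤ (ENNReal.ofReal η + K) * ‖P‖ₑ / ENNReal.ofReal η := by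
    refine hle.trans ?_
    rw [setLAverage_eq, hv]
    gcongr
    exact hv ▸ lintegral_enorm_restrict0_le hf (by simp [hv]) P
  have htop : (ENNReal.ofReal η + K) * ‖P‖ₑ / ENNReal.ofReal η ≠ ∞ :=
    ENNReal.div_ne_top (ENNReal.mul_ne_top (by simp) enorm_ne_top) (by simpa using hη)
  simpa [ENNReal.toReal_add, hη.le] using ENNReal.toReal_mono htop hbound

theorem exists_norm_portionIn_thickening_sub_le (P Q : ZeroChain X G) {η : ℝ} (hη : 0 < η) :
    ∃ r ∈ Set.Ioo 0 η,
      ‖portionIn (Metric.thickening r (coeff Q).support) P - Q‖ ≤ (η + 1) * ‖P - Q‖ / η := by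
  rcases (coeff Q).support.eq_empty_or_nonempty with hQ | hQ
  · refine ⟨η / 2, ⟨half_pos hη, half_lt_self hη⟩, ?_⟩
    have h0 : portionIn (∅ : Set X) P = 0 := Finsupp.support_eq_empty.1
      (Finset.coe_eq_empty.1 (Set.subset_empty_iff.1 (support_portionIn_subset ∅ P)))
    have hQ0 : Q = 0 := Finsupp.support_eq_empty.1 hQ
    rw [hQ, Finset.coe_empty, Metric.thickening_empty, h0, hQ0, sub_zero, norm_zero]
    positivity
  · obtain ⟨r, hr, hle⟩ :=
      exists_norm_restrict0_le (Metric.lipschitz_infDist_pt (↑(coeff Q).support : Set X)) (P - Q) hη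
    have hthick : {x : X | Metric.infDist x (coeff Q).support < r} =
        Metric.thickening r (coeff Q).support := by
      ext x
      rw [Metric.mem_thickening_iff_infDist_lt (Finset.coe_nonempty.2 hQ), Set.mem_ofPred_eq]
    have hself : portionIn (Metric.thickening r (coeff Q).support) Q = Q :=
      portionIn_eq_self (Metric.self_subset_thickening hr.1 _)
    rw [restrict0_eq_portionIn, hthick, map_sub, hself] at hle
    exact ⟨r, hr, by simpa using hle⟩

end Slicing

section Mass

variable {X G ι : Type*} [NormedAddCommGroup X] [NormedSpace ℝ X] [NormedAddCommGroup G]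
  {A : FlatZeroChain X G} {l : Filter ι} {P : ι → ZeroChain X G}

theorem eventually_lt_mass0 (hP : Tendsto (fun i => (P i : FlatZeroChain X G)) l (𝓝 A))
    {c : ℝ≥0∞} (hc : c < mass A) : ∀ᶠ i in l, c < mass0 (P i) := by
  suffices h : ∀ᶠ Q in comap ((↑) : ZeroChain X G → FlatZeroChain X G) (𝓝 A), c < mass0 Q from
    (tendsto_comap_iff.2 hP : Tendsto P l (comap (↑) (𝓝 A))).eventually h
  by_contra h
  obtain ⟨Q, hQ, hQc⟩ := exists_seq_forall_of_frequently (not_eventually.1 h)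
  obtain ⟨m, φ, hφ, hm⟩ := CompactSpace.tendsto_subseq fun n => mass0 (Q n)
  have hmc : m ≤ c := le_of_tendsto' hm fun n => not_lt.1 (hQc (φ n))
  have hAm : mass A ≤ m :=
    sInf_le ⟨fun n => Q (φ n), (tendsto_comap_iff.1 hQ).comp hφ.tendsto_atTop, hm⟩
  exact (hAm.trans hmc).not_gt hc

theorem tendsto_massMeasure_compl_zero {E : ι → Set X} (hA : mass A ≠ ∞)
    (hP : Tendsto (fun i => mass0 (P i)) l (𝓝 (mass A)))
    (hE : Tendsto (fun i => (portionIn (E i) (P i) : FlatZeroChain X G)) l (𝓝 A)) :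
    Tendsto (fun i => massMeasure (P i) (E i)ᶜ) l (𝓝 0) := by
  have hmass : Tendsto (fun i => mass0 (portionIn (E i) (P i))) l (𝓝 (mass A)) :=
    tendsto_order.2 ⟨fun c hc => eventually_lt_mass0 hE hc, fun c hc =>
      (hP.eventually_lt_const hc).mono fun i hi => (mass0_portionIn_le _ _).trans_lt hi⟩
  have hcompl (i : ι) : massMeasure (P i) (E i)ᶜ = mass0 (P i) - mass0 (portionIn (E i) (P i)) :=
    ENNReal.eq_sub_of_add_eq (mass0_ne_top _)
      (by rw [mass0_portionIn, add_comm, massMeasure_add_massMeasure_compl])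
  simpa only [hcompl, tsub_self] using ENNReal.Tendsto.sub hP hmass (.inl hA)

/-- `P` is a recovery sequence for the flat chain `A`: it converges rapidly to `A`, and no mass is
lost in the limit. -/
structure Recovers (P : ℕ → ZeroChain X G) (A : FlatZeroChain X G) : Prop where
  rapid : ConvergesRapidly P A
  tendsto_mass0 : Tendsto (fun i => mass0 (P i)) atTop (𝓝 (mass A))

theorem exists_norm_sub_lt_mass0_lt {c : ℝ≥0∞} (hc : mass A < c) {ε : ℝ} (hε : 0 < ε) :
    ∃ P : ZeroChain X G, ‖(P : FlatZeroChain X G) - A‖ < ε ∧ mass0 P < c := by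
  obtain ⟨m, ⟨P, hP, hm⟩, hmc⟩ := sInf_lt_iff.1 hc
  obtain ⟨i, hi⟩ := ((tendsto_iff_norm_sub_tendsto_zero.1 hP).eventually_lt_const hε
    |>.and (hm.eventually_lt_const hmc)).exists
  exact ⟨P i, hi⟩

theorem exists_recovers (hA : mass A ≠ ∞) : ∃ P : ℕ → ZeroChain X G, Recovers P A := by
  have hlt (n : ℕ) : mass A < mass A + (n : ℝ≥0∞)⁻¹ :=
    ENNReal.lt_add_right hA (ENNReal.inv_ne_zero.2 (ENNReal.natCast_ne_top n))
  choose P hP hPm using fun n : ℕ =>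
    exists_norm_sub_lt_mass0_lt (hlt n) (ε := (1 / 2) ^ n) (by positivity)
  have hrapid : ConvergesRapidly P A :=
    summable_geometric_two.of_nonneg_of_le (fun _ => norm_nonneg _) fun i => (hP i).le
  have hupper : Tendsto (fun n : ℕ => mass A + (n : ℝ≥0∞)⁻¹) atTop (𝓝 (mass A)) := by
    simpa using ENNReal.tendsto_inv_nat_nhds_zero.const_add (mass A)
  exact ⟨P, hrapid, tendsto_order.2 ⟨fun c hc => eventually_lt_mass0 hrapid.tendsto hc,
    fun c hc => (hupper.eventually_lt_const hc).mono fun n hn => (hPm n).trans hn⟩⟩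

end Mass

section Concentration

/-- The filter of sets on which the masses of the chains `P i` concentrate as `i → ∞`. -/
noncomputable def concentrationFilter {X G : Type*} [NormedAddCommGroup G]
    (P : ℕ → ZeroChain X G) : Filter X :=
  .comk (fun E => Tendsto (fun i => massMeasure (P i) E) atTop (𝓝 0)) (by simp)
    (fun _ hE _ hFE => tendsto_of_tendsto_of_tendsto_of_le_of_le tendsto_const_nhds hE
      (fun _ => zero_le) fun i => (massMeasure (P i)).mono hFE)
    fun E hE F hF => tendsto_of_tendsto_of_tendsto_of_le_of_le tendsto_const_nhds
      (by simpa using hE.add hF) (fun _ => zero_le) fun i => measure_union_le E F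

variable {X G : Type*} [NormedAddCommGroup X] [NormedSpace ℝ X] [NormedAddCommGroup G]
  {A : FlatZeroChain X G} {P : ℕ → ZeroChain X G}

theorem Recovers.exists_finset_massMeasure_le (h : Recovers P A) (hA : mass A ≠ ∞) {ε : ℝ≥0∞}
    (hε : ε ≠ 0) {η : ℝ} (hη : 0 < η) :
    ∃ S : Finset X, ∀ᶠ i in atTop, massMeasure (P i) (Metric.thickening η S)ᶜ ≤ ε := by
  choose r hr hle using fun p : ℕ × ℕ =>
    exists_norm_portionIn_thickening_sub_le (P p.2) (P p.1) hη
  have hfst := h.rapid.tendsto.comp (tendsto_fst (f := atTop) (g := (atTop : Filter ℕ)))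
  have hsnd := h.rapid.tendsto.comp (tendsto_snd (f := (atTop : Filter ℕ)) (g := atTop))
  have hnorm (p : ℕ × ℕ) : dist (P p.2 : FlatZeroChain X G) (P p.1) = ‖P p.2 - P p.1‖ := by
    rw [UniformSpace.Completion.dist_eq, dist_eq_norm]
  have hdist : Tendsto (fun p : ℕ × ℕ => ‖P p.2 - P p.1‖) (atTop ×ˢ atTop) (𝓝 0) :=
    (dist_self A ▸ hsnd.dist hfst).congr hnorm
  have hlim : Tendsto (fun p : ℕ × ℕ => (portionIn (Metric.thickening (r p) (coeff (P p.1)).support)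
      (P p.2) : FlatZeroChain X G)) (atTop ×ˢ atTop) (𝓝 A) := by
    refine hfst.congr_dist (squeeze_zero (fun _ => dist_nonneg) (fun p => ?_)
      (by simpa only [mul_zero, zero_div] using (hdist.const_mul (η + 1)).div_const η))
    rw [Function.comp_apply, dist_comm, UniformSpace.Completion.dist_eq, dist_eq_norm]
    exact hle p
  have hsmall := (tendsto_massMeasure_compl_zero hA (h.tendsto_mass0.comp tendsto_snd) hlim
    |>.eventually_le_const hε.bot_lt).curry
  obtain ⟨i, hi⟩ := hsmall.exists
  refine ⟨(coeff (P i)).support, hi.mono fun j hj => le_trans ?_ hj⟩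
  exact (massMeasure (P j)).mono
    (Set.compl_subset_compl.2 (Metric.thickening_mono (hr (i, j)).2.le _))

theorem Recovers.exists_frequently_mem_and_dist_lt (h : Recovers P A) (hA : mass A ≠ ∞) {E : Set X}
    (hE : ∃ᶠ z in concentrationFilter P, z ∈ E) {η : ℝ} (hη : 0 < η) :
    ∃ s, ∃ᶠ z in concentrationFilter P, z ∈ E ∧ dist z s < η := by
  by_contra hs
  simp only [not_exists, not_frequently] at hs
  refine hE (ENNReal.tendsto_nhds_zero.2 fun ε hε => ?_)
  obtain ⟨S, hS⟩ := h.exists_finset_massMeasure_le hA (ENNReal.half_pos hε.ne').ne' hη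
  have hW := (ENNReal.tendsto_nhds_zero.1 <| (eventually_all_finset S).2 fun s _ => hs s) (ε / 2)
    (ENNReal.half_pos hε.ne')
  filter_upwards [hS, hW] with i hi hi'
  refine (((massMeasure (P i)).mono fun z hz => ?_).trans (measure_union_le _ _)).trans
    ((add_le_add hi hi').trans_eq (ENNReal.add_halves ε))
  by_cases hzS : z ∈ Metric.thickening η (S : Set X)
  · obtain ⟨s, hs, hzs⟩ := Metric.mem_thickening_iff.1 hzS
    exact .inr fun hzW => hzW s hs ⟨not_not.1 hz, hzs⟩
  · exact .inl hzS

theorem exists_mem_closure_clusterPt {X : Type*} [PseudoMetricSpace X] [CompleteSpace X]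
    {F : Filter X}
    (hF : ∀ E : Set X, (∃ᶠ z in F, z ∈ E) → ∀ η > 0, ∃ s, ∃ᶠ z in F, z ∈ E ∧ dist z s < η)
    {Z : Set X} (hZ : ∃ᶠ z in F, z ∈ Z) : ∃ y ∈ closure Z, ClusterPt y F := by
  choose s hs using hF
  let E : ℕ → {E : Set X // ∃ᶠ z in F, z ∈ E} := Nat.rec ⟨Z, hZ⟩ fun n E =>
    ⟨{z | z ∈ E.1 ∧ dist z (s E.1 E.2 ((1 / 2) ^ n) (by positivity)) < (1 / 2) ^ n},
      hs E.1 E.2 ((1 / 2) ^ n) (by positivity)⟩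
  have hE (n : ℕ) : ∃ x, (E (n + 1)).1 ⊆ Metric.ball x ((1 / 2) ^ n) := ⟨_, fun _ hz => hz.2⟩
  have hanti : Antitone fun n => F ⊓ 𝓟 (E n).1 :=
    antitone_nat_of_succ_le fun n => inf_le_inf_left F (principal_mono.2 fun _ hz => hz.1)
  have hne (n : ℕ) : (F ⊓ 𝓟 (E n).1).NeBot := frequently_mem_iff_neBot.1 (E n).2
  have hcauchy : Cauchy (⨅ n, F ⊓ 𝓟 (E n).1) := by
    refine Metric.cauchy_iff.2 ⟨iInf_neBot_of_directed' hanti.directed_ge hne, fun ε hε => ?_⟩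
    obtain ⟨n, hn⟩ := exists_pow_lt_of_lt_one (half_pos hε) (one_half_lt_one (α := ℝ))
    obtain ⟨x, hx⟩ := hE n
    refine ⟨(E (n + 1)).1, mem_iInf_of_mem (n + 1) (mem_inf_of_right (mem_principal_self _)),
      fun y hy z hz => ?_⟩
    linarith [dist_triangle_right y z x, Metric.mem_ball.1 (hx hy), Metric.mem_ball.1 (hx hz)]
  obtain ⟨y, hy⟩ := CompleteSpace.complete hcauchy
  have := hcauchy.1
  have hle : ⨅ n, F ⊓ 𝓟 (E n).1 ≤ F ⊓ 𝓟 Z := iInf_le _ 0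
  exact ⟨y, mem_closure_iff_clusterPt.2 (.mono (.of_le_nhds hy) (hle.trans inf_le_right)),
    .mono (.of_le_nhds hy) (hle.trans inf_le_left)⟩

theorem Recovers.mem_spt_of_clusterPt (h : Recovers P A) (hA : mass A ≠ ∞) {x : X}
    (hx : ClusterPt x (concentrationFilter P)) : x ∈ spt A := by
  intro Q hQ
  obtain ⟨r, hr_anti, hr, hr_lim⟩ := (Measure.dense_of_ae (h.rapid.ae_exists_isRestriction hQ
    (LipschitzWith.dist_left x))).exists_seq_strictAnti_tendsto 0
  refine ⟨r, hr_anti, fun j => (hr j).1, hr_lim, fun j => ?_⟩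
  obtain ⟨B, hPB, hQB⟩ := (hr j).2
  refine ⟨B, hQB, norm_pos_iff.2 fun hB => ?_⟩
  have hball : Tendsto (fun i => (portionIn (Metric.ball x (r j)) (P i) : FlatZeroChain X G))
      atTop (𝓝 0) := by
    simpa only [hB, restrict0_eq_portionIn] using! hPB.2
  have hcompl : Tendsto (fun i => (portionIn (Metric.ball x (r j))ᶜ (P i) : FlatZeroChain X G))
      atTop (𝓝 A) := by
    have hsub (i : ℕ) : portionIn (Metric.ball x (r j))ᶜ (P i) =
        P i - portionIn (Metric.ball x (r j)) (P i) :=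
      eq_sub_of_add_eq' (portionIn_add_portionIn_compl _ _)
    simpa only [hsub, UniformSpace.Completion.coe_sub, sub_zero] using h.rapid.tendsto.sub hball
  have hmem : (Metric.ball x (r j))ᶜ ∈ concentrationFilter P :=
    tendsto_massMeasure_compl_zero hA h.tendsto_mass0 hcompl
  obtain ⟨z, hz, hz'⟩ := (clusterPt_iff_nonempty.1 hx) (Metric.ball_mem_nhds x (hr j).1) hmem
  exact hz' hz

theorem Recovers.concentrationFilter_le_nhdsSet_spt [CompleteSpace X] (h : Recovers P A)
    (hA : mass A ≠ ∞) : concentrationFilter P ≤ 𝓝ˢ (spt A) := by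
  refine (hasBasis_nhdsSet (spt A)).ge_iff.2 fun U hU => ?_
  by_contra hUF
  have hfreq : ∃ᶠ z in concentrationFilter P, z ∈ Uᶜ := not_eventually.1 hUF
  obtain ⟨y, hyU, hy⟩ := exists_mem_closure_clusterPt
    (fun E hE η hη => h.exists_frequently_mem_and_dist_lt hA hE hη) hfreq
  rw [hU.1.isClosed_compl.closure_eq] at hyU
  exact hyU (hU.2 (h.mem_spt_of_clusterPt hA hy))

end Concentration

section TotallyBounded

theorem totallyBounded_univ_pi {ι : Type*} {α : ι → Type*} [∀ i, UniformSpace (α i)]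
    {s : ∀ i, Set (α i)} (hs : ∀ i, TotallyBounded (s i)) : TotallyBounded (Set.univ.pi s) := by
  refine totallyBounded_iff_ultrafilter.2 fun l hl => (cauchy_pi_iff' α).2 fun i => ?_
  refine (l.map (Function.eval i)).cauchy_of_totallyBounded (hs i) ?_
  have hmaps : Set.MapsTo (Function.eval i) (Set.univ.pi s) (s i) := fun x hx => hx i trivial
  exact (map_mono hl).trans (map_principal.trans_le (principal_mono.2 hmaps.image_subset))

theorem totallyBounded_of_forall_subset_thickening {α : Type*} [PseudoMetricSpace α] {s : Set α}
    (h : ∀ ε > 0, ∃ t, TotallyBounded t ∧ s ⊆ Metric.thickening ε t) : TotallyBounded s := by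
  refine Metric.totallyBounded_iff.2 fun ε hε => ?_
  obtain ⟨t, ht, hst⟩ := h (ε / 2) (half_pos hε)
  obtain ⟨u, hu, htu⟩ := Metric.totallyBounded_iff.1 ht (ε / 2) (half_pos hε)
  rw [← Metric.thickening_eq_biUnion_ball] at htu
  refine ⟨u, hu, ?_⟩
  rw [← Metric.thickening_eq_biUnion_ball, ← add_halves ε]
  exact (hst.trans (Metric.thickening_subset_of_subset _ htu)).trans
    (Metric.thickening_thickening_subset _ _ u)

end TotallyBounded

section Pushforward

variable {X Y G : Type*} [NormedAddCommGroup G]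

/-- The pushforward `π_# P` of a `0`-chain under an arbitrary map `π` of the underlying spaces. -/
noncomputable def pushforward (π : X → Y) : ZeroChain X G →+ ZeroChain Y G :=
  Finsupp.mapDomain.addMonoidHom π

theorem pushforward_eq_sum (π : X → Y) (P : ZeroChain X G) :
    pushforward π P = (coeff P).sum fun x g => pt (π x) g := rfl

theorem support_pushforward_subset (π : X → Y) (P : ZeroChain X G) :
    ↑(coeff (pushforward π P)).support ⊆ π '' (coeff P).support := by
  classical
  rw [← Finset.coe_image]
  exact Finset.coe_subset.2 (Finsupp.mapDomain_support (f := π) (s := coeff P))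

theorem mass0_pushforward_le (π : X → Y) (P : ZeroChain X G) :
    mass0 (pushforward π P) ≤ mass0 P := by
  rw [pushforward_eq_sum, mass0_eq_sum P]
  refine (Finset.le_sum_of_subadditive mass0 mass0_zero.le mass0_add_le _ _).trans_eq ?_
  exact Finset.sum_congr rfl fun x _ => mass0_pt (π x) _

variable [NormedAddCommGroup X] [NormedSpace ℝ X]

theorem enorm_sub_pushforward_le {π : X → X} {P : ZeroChain X G} {η : ℝ≥0∞}
    (h : ∀ x ∈ (coeff P).support, edist x (π x) ≤ η) : ‖P - pushforward π P‖ₑ ≤ mass0 P * η := by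
  have hsum : P - pushforward π P =
      ∑ x ∈ (coeff P).support, (pt x (coeff P x) - pt (π x) (coeff P x)) := by
    rw [Finset.sum_sub_distrib]
    exact congrArg (· - pushforward π P) (sum_pt_coeff P).symm
  calc ‖P - pushforward π P‖ₑ
    _ ≤ ∑ x ∈ (coeff P).support, ‖pt x (coeff P x) - pt (π x) (coeff P x)‖ₑ :=
        hsum ▸ enorm_zeroChain_sum_le _ _
    _ ≤ ∑ x ∈ (coeff P).support, ‖coeff P x‖ₑ * η := Finset.sum_le_sum fun x hx =>
        (enorm_pt_sub_pt_le _ _ _).trans (mul_le_mul_right (edist_comm (π x) x ▸ h x hx) _)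
    _ = mass0 P * η := (Finset.sum_mul _ _ _).symm

theorem exists_support_subset_norm_sub_le {P : ZeroChain X G} {m : ℝ≥0} (hm : mass0 P ≤ m)
    {T : Set X} {δ : ℝ} (hδ : 0 ≤ δ) (hT : ↑(coeff P).support ⊆ Metric.thickening δ T) :
    ∃ Q : ZeroChain X G, ↑(coeff Q).support ⊆ T ∧ mass0 Q ≤ mass0 P ∧ ‖P - Q‖ ≤ m * δ := by
  choose! π hπT hπ using fun x (hx : x ∈ (coeff P).support) =>
    (Metric.mem_thickening_iff_exists_edist_lt T x).1 (hT hx)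
  refine ⟨pushforward π P, (support_pushforward_subset π P).trans (Set.image_subset_iff.2 hπT),
    mass0_pushforward_le π P, ?_⟩
  have hle := (enorm_sub_pushforward_le fun x hx => (hπ x hx).le).trans
    (mul_le_mul_left hm (ENNReal.ofReal δ))
  simpa [ENNReal.toReal_ofReal hδ] using ENNReal.toReal_mono (by finiteness) hle

end Pushforward

section Compactness

variable {X G : Type*} [NormedAddCommGroup X] [NormedSpace ℝ X] [NormedAddCommGroup G]

theorem exists_support_subset_norm_sub_lt [CompleteSpace X] {A : FlatZeroChain X G}
    {c : ℝ≥0∞} (hc : mass A < c) {U : Set X} (hU : U ∈ 𝓝ˢ (spt A)) {ε : ℝ} (hε : 0 < ε) :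
    ∃ P : ZeroChain X G, ↑(coeff P).support ⊆ U ∧ mass0 P < c ∧
      ‖(P : FlatZeroChain X G) - A‖ < ε := by
  obtain ⟨P, hP⟩ := exists_recovers hc.ne_top
  have hcompl : Tendsto (fun i => massMeasure (P i) Uᶜ) atTop (𝓝 0) :=
    hP.concentrationFilter_le_nhdsSet_spt hc.ne_top hU
  have hlim : Tendsto (fun i => (portionIn U (P i) : FlatZeroChain X G)) atTop (𝓝 A) := by
    refine hP.rapid.tendsto.congr_dist (squeeze_zero (fun _ => dist_nonneg) (fun i => ?_)
      ((ENNReal.tendsto_toReal ENNReal.zero_ne_top).comp hcompl))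
    rw [UniformSpace.Completion.dist_eq, dist_eq_norm, ← toReal_enorm, Function.comp_apply,
      ← mass0_portionIn, sub_eq_of_eq_add' (portionIn_add_portionIn_compl U (P i)).symm]
    exact ENNReal.toReal_mono (mass0_ne_top _) (enorm_le_mass0 _)
  obtain ⟨i, hi, hi'⟩ := ((hP.tendsto_mass0.eventually_lt_const hc).and
    ((tendsto_iff_norm_sub_tendsto_zero.1 hlim).eventually_lt_const hε)).exists
  exact ⟨portionIn U (P i), support_portionIn_subset _ _,
    (mass0_portionIn_le _ _).trans_lt hi, hi'⟩

theorem exists_support_subset_spt_norm_sub_lt [CompleteSpace X] {A : FlatZeroChain X G}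
    {c : ℝ≥0∞} (hc : mass A < c) {ε : ℝ} (hε : 0 < ε) :
    ∃ P : ZeroChain X G, ↑(coeff P).support ⊆ spt A ∧ mass0 P < c ∧
      ‖(P : FlatZeroChain X G) - A‖ < ε := by
  obtain ⟨m, hAm, hmc⟩ := ENNReal.lt_iff_exists_nnreal_btwn.1 hc
  obtain ⟨δ, hδ, hδε⟩ : ∃ δ > 0, m * δ < ε / 2 := exists_pos_mul_lt (half_pos hε) m
  obtain ⟨P, hPU, hPm, hPA⟩ := exists_support_subset_norm_sub_lt hAm
    (Metric.isOpen_thickening.mem_nhdsSet.2 (Metric.self_subset_thickening hδ _)) (half_pos hε)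
  obtain ⟨Q, hQ, hQP, hPQ⟩ := exists_support_subset_norm_sub_le hPm.le hδ.le hPU
  refine ⟨Q, hQ, (hQP.trans_lt hPm).trans hmc, ?_⟩
  rw [← dist_eq_norm] at hPA ⊢
  rw [← dist_eq_norm, ← UniformSpace.Completion.dist_eq] at hPQ
  linarith [dist_triangle_left (Q : FlatZeroChain X G) A P]

theorem continuous_pt (x : X) : Continuous (pt x : G → ZeroChain X G) := by
  refine AddMonoidHomClass.continuous_of_bound (pt x) 1 fun g => ?_
  rw [one_mul, ← enorm_le_iff_norm_le]
  exact (enorm_le_mass0 _).trans_eq (mass0_pt x g)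

theorem totallyBounded_support_subset_finset_mass0_le
    (hG : ∀ d : ℝ, TotallyBounded {g : G | ‖g‖ ≤ d}) (T : Finset X) (m : ℝ≥0) :
    TotallyBounded {P : ZeroChain X G | ↑(coeff P).support ⊆ (T : Set X) ∧ mass0 P ≤ m} := by
  have hpt (t : X) : UniformContinuous (pt t : G → ZeroChain X G) :=
    uniformContinuous_addMonoidHom_of_continuous (continuous_pt t)
  have hsum : UniformContinuous fun c : X → G => (∑ t ∈ T, pt t (c t) : ZeroChain X G) :=
    Finset.uniformContinuous_sum T fun t _ => (hpt t).comp (Pi.uniformContinuous_proj _ t)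
  refine ((totallyBounded_univ_pi fun _ => hG m).image hsum).subset ?_
  rintro P ⟨hPT, hPm⟩
  refine ⟨coeff P, fun x _ => ?_, ?_⟩
  · simpa using ENNReal.toReal_mono ENNReal.coe_ne_top ((enorm_coeff_le_mass0 P x).trans hPm)
  · refine Eq.trans ?_ (sum_pt_coeff P)
    exact (Finsupp.sum_of_support_subset _ (Finset.coe_subset.1 hPT) _ fun x _ => map_zero _).symm

theorem totallyBounded_support_subset_mass0_le
    (hG : ∀ d : ℝ, TotallyBounded {g : G | ‖g‖ ≤ d}) {K : Set X} (hK : TotallyBounded K)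
    (m : ℝ≥0) :
    TotallyBounded {P : ZeroChain X G | ↑(coeff P).support ⊆ K ∧ mass0 P ≤ m} := by
  refine totallyBounded_of_forall_subset_thickening fun ε hε => ?_
  obtain ⟨δ, hδ, hδε⟩ : ∃ δ > 0, m * δ < ε := exists_pos_mul_lt hε m
  obtain ⟨T, hT, hKT⟩ := Metric.totallyBounded_iff.1 hK δ hδ
  lift T to Finset X using hT
  refine ⟨_, totallyBounded_support_subset_finset_mass0_le hG T m, ?_⟩
  rintro P ⟨hPK, hPm⟩
  rw [← Metric.thickening_eq_biUnion_ball] at hKT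
  obtain ⟨Q, hQT, hQP, hPQ⟩ := exists_support_subset_norm_sub_le hPm hδ.le (hPK.trans hKT)
  refine Metric.mem_thickening_iff.2 ⟨Q, ⟨hQT, hQP.trans hPm⟩, ?_⟩
  exact (dist_eq_norm P Q).trans_lt (hPQ.trans_lt hδε)

theorem totallyBounded_spt_subset_mass_le [CompleteSpace X]
    (hG : ∀ d : ℝ, TotallyBounded {g : G | ‖g‖ ≤ d}) {K : Set X} (hK : TotallyBounded K)
    (q : ℝ≥0) : TotallyBounded {A : FlatZeroChain X G | spt A ⊆ K ∧ mass A ≤ q} := by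
  refine ((totallyBounded_support_subset_mass0_le hG hK (q + 1)).image
    (UniformSpace.Completion.uniformContinuous_coe _)).closure.subset ?_
  rintro A ⟨hAK, hAq⟩
  have hAq' : mass A < ↑(q + 1) := hAq.trans_lt (by exact_mod_cast lt_add_one q)
  refine Metric.mem_closure_iff.2 fun ε hε => ?_
  obtain ⟨P, hPA, hPm, hP⟩ := exists_support_subset_spt_norm_sub_lt hAq' hε
  refine ⟨P, ⟨P, ⟨hPA.trans hAK, hPm.le⟩, rfl⟩, ?_⟩
  rwa [dist_comm, dist_eq_norm]

end Compactness

end FlatChain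

theorem mainTheorem7_general {X G : Type*} [NormedAddCommGroup X] [NormedSpace ℝ X]
    [CompleteSpace X] [NormedAddCommGroup G]
    (A : ℕ → FlatChain.FlatZeroChain X G)
    (hG : ∀ d : ℝ, TotallyBounded {g : G | ‖g‖ ≤ d})
    (K : Set X) (hK : TotallyBounded K) (hA : ∀ j, FlatChain.spt (A j) ⊆ K)
    (q : ℝ≥0) (hq : ∀ j, FlatChain.mass (A j) ≤ q) :
    ∃ (φ : ℕ → ℕ) (B : FlatChain.FlatZeroChain X G),
      StrictMono φ ∧ Tendsto (fun j => A (φ j)) atTop (𝓝 B) := by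
  have hcompact : IsCompact
      (closure {A : FlatChain.FlatZeroChain X G | FlatChain.spt A ⊆ K ∧ FlatChain.mass A ≤ q}) :=
    (FlatChain.totallyBounded_spt_subset_mass_le hG hK q).closure.isCompact_of_isClosed
      isClosed_closure
  obtain ⟨B, -, φ, hφ, hB⟩ := hcompact.tendsto_subseq fun j => subset_closure ⟨hA j, hq j⟩
  exact ⟨φ, B, hφ, hB⟩

theorem mainTheorem7 {X G : Type*} [NormedAddCommGroup X] [NormedSpace ℝ X] [CompleteSpace X]
    [NormedAddCommGroup G] [CompleteSpace G]
    (A : ℕ → FlatChain.FlatZeroChain X G)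
    (hG : ∀ d : ℝ, IsCompact {g : G | ‖g‖ ≤ d})
    (K : Set X) (hK : IsCompact K) (hA : ∀ j, FlatChain.spt (A j) ⊆ K)
    (q : ℝ≥0) (hq : ∀ j, FlatChain.mass (A j) ≤ q) :
    ∃ (φ : ℕ → ℕ) (B : FlatChain.FlatZeroChain X G),
      StrictMono φ ∧ Tendsto (fun j => A (φ j)) atTop (𝓝 B) :=
  mainTheorem7_general A (fun d => (hG d).totallyBounded) K hK.totallyBounded hA q hq
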